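/- Theorem 4.1 ($SDP_0$ bound). Let $\mathbf M$ be a compact metric space with distance $\rho$ on which a group $G$ acts by isometries so that whenever $\rho(x,y)=\rho(x',y')$ there is $g\in G$ with $gx=x'$, $gy=y'$ (a compact 2-point-homogeneous space; finite spaces are included), and let $\mu$ be its $G$-invariant Borel probability measure. Let $\tau(x,y)=F(\rho(x,y))$ for a function $F:\mathbf R\to\mathbf R$, $\tau_0=F(0)=\tau(x,x)$, and $T=\{\tau(x,y):x,y\in\mathbf M\}$. Let $I=\{k\in\mathbf Z_{\ge0}: k<|T|\}$ (so $I=\{0,1,2,\dots\}$ if $T$ is infinite). Let $\Phi_k$, $k\in I$, be the zonal spherical functions of $\mathbf M$, assumed to be polynomials of degree $k$ in $\tau$: there is an orthogonal decomposition $L^2(\mathbf M,\mu)=\bigoplus_{k\in I}V_k$ of the space of complex square-integrable functions into irreducible $G$-invariant finite-dimensional spaces $V_k$ of continuous functions, and for each $k\in I$, $$\Phi_k(t)=p_{k0}+p_{k1}t+\dots+p_{kk}t^k$$ is a real polynomial of degree $k$ with $\Phi_k(\tau_0)=1$ such that for every $y\in\mathbf M$ the function $x\mapsto\Phi_k(\tau(x,y))$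 belongs to $V_k$. Let $a,b$ be real numbers and $S=T\cap[a,b]$. An $S$-code is a finite set $C\subset\mathbf M$ with $\tau(x,y)\in S$ for all distinct $x,y\in C$, and $A(\mathbf M,S)$ is the largest cardinality of an $S$-code. Let $m\ge1$ be an integer. For real $x_1,\dots,x_{2m-1}$ put $x_0=1$ and let $\bar H_m(x_1,\dots,x_{2m-1},[a,b])$ be the block diagonal matrix with the three $m\times m$ blocks $$(x_{i+j})_{0\le i,j<m},\qquad (x_{i+j+1}-a\,x_{i+j})_{0\le i,j<m},\qquad (b\,x_{i+j}-x_{i+j+1})_{0\le i,j<m}.$$ The $SDP_0$ problem is to minimize $y$ over all real $y,x_1,\dots,x_{2m-1}$ subject to $$y+\sum_{i=1}^k p_{ki}x_i\ge -p_{k0}\quad (1\le k\le 2m-1,\ k\in I),\qquad \bar H_m(x_1,\dots,x_{2m-1},[a,b])\succeq0.$$ Let the real number $y^*$ be its optimal value (the infimum, whether attained or not), and suppose that $y^*>0$. Then $$A(\mathbf M,S)\le\frac{1+y^*}{y^*};$$ in particular $A(\mathbf M,S)$ is finite. -/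

import Mathlib

open MeasureTheory
open scoped ENNReal

namespace TwoPointCodes

/-- The group `G` acts on the metric space `M` by isometries, and any two pairs of points at the same
distance are related by an element of `G`: `M` is a 2-point-homogeneous `G`-space. -/
structure IsTwoPointHomogeneous (G M : Type*) [MetricSpace M] [Group G] [MulAction G M] : Prop where
  isometric : ∀ (g : G) (x y : M), dist (g • x) (g • y) = dist x y
  homogeneous : ∀ x y x' y' : M, dist x y = dist x' y' → ∃ g : G, g • x = x' ∧ g • y = y'

/-- The function `τ(x,y) = F(ρ(x,y))` of the distance. -/
def tau {M : Type*} [MetricSpace M] (F : ℝ → ℝ) (x y : M) : ℝ := F (dist x y)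

/-- The set `T = {τ(x,y) : x, y ∈ M}`. -/
def tauRange (M : Type*) [MetricSpace M] (F : ℝ → ℝ) : Set ℝ :=
  {t | ∃ x y : M, tau F x y = t}

/-- The indices `k` of the zonal spherical functions `Φ_k`: all natural numbers if `T` is infinite, and
`0, …, |T| - 1` if `T` is finite. -/
def zonalIndex (M : Type*) [MetricSpace M] (F : ℝ → ℝ) : Set ℕ :=
  {k | (k : ℕ∞) < (tauRange M F).encard}

/-- A space of complex functions on `M` that is stable under all translations by elements of `G`. -/
def IsInvariantSpace (G : Type*) {M : Type*} [Group G] [MulAction G M]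
    (W : Submodule ℂ (M → ℂ)) : Prop :=
  ∀ g : G, ∀ f ∈ W, (fun x => f (g • x)) ∈ W

/-- A decomposition `L²(M, μ) = ⨁ V_k`, `k ∈ I`, into pairwise orthogonal irreducible `G`-invariant
finite-dimensional spaces (of continuous functions). -/
structure IsHarmonicDecomposition (G : Type*) {M : Type*} [MetricSpace M] [MeasurableSpace M]
    [Group G] [MulAction G M] (μ : Measure M) (I : Set ℕ) (V : ℕ → Submodule ℂ (M → ℂ)) :
    Prop where
  finite : ∀ k ∈ I, Module.Finite ℂ (V k)
  continuous : ∀ k ∈ I, ∀ f ∈ V k, Continuous f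
  invariant : ∀ k ∈ I, IsInvariantSpace G (V k)
  nontrivial : ∀ k ∈ I, V k ≠ ⊥
  irreducible : ∀ k ∈ I, ∀ W : Submodule ℂ (M → ℂ), W ≤ V k → IsInvariantSpace G W →
    W = ⊥ ∨ W = V k
  orthogonal : ∀ k ∈ I, ∀ l ∈ I, k ≠ l → ∀ f ∈ V k, ∀ g ∈ V l,
    ∫ x, f x * (starRingEnd ℂ) (g x) ∂μ = 0
  complete : ∀ f : M → ℂ, MemLp f 2 μ →
    (∀ k ∈ I, ∀ g ∈ V k, ∫ x, f x * (starRingEnd ℂ) (g x) ∂μ = 0) → f =ᵐ[μ] 0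

/-- The real polynomials `Φ_k`, `k = 0, 1, …`, are the zonal spherical functions of `M` with respect
to `τ = F ∘ ρ`: for the irreducible components `V_k` of `L²(M, μ)`, the function `x ↦ Φ_k(τ(x,y))` is,
for every pole `y`, the member of `V_k` that depends on the distance to `y` only and takes the value
`1` at `y`; moreover `Φ_k` has degree `k`. -/
def IsZonalFamily (G : Type*) {M : Type*} [MetricSpace M] [MeasurableSpace M]
    [Group G] [MulAction G M] (μ : Measure M) (F : ℝ → ℝ) (Φ : ℕ → Polynomial ℝ) : Prop :=
  ∃ V : ℕ → Submodule ℂ (M → ℂ), IsHarmonicDecomposition G μ (zonalIndex M F) V ∧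
    ∀ k ∈ zonalIndex M F,
      (Φ k).degree = (k : WithBot ℕ) ∧ (Φ k).eval (F 0) = 1 ∧
      ∀ y : M, (fun x : M => (((Φ k).eval (tau F x y) : ℝ) : ℂ)) ∈ V k

/-- A finite set `C` with `τ(x,y) ∈ S` for all distinct `x, y ∈ C`. -/
def IsCode {M : Type*} [MetricSpace M] (F : ℝ → ℝ) (S : Set ℝ) (C : Finset M) : Prop :=
  ∀ x ∈ C, ∀ y ∈ C, x ≠ y → tau F x y ∈ S

/-- `A(M,S)`, the largest cardinality of an `S`-code (`⊤` if there are arbitrarily large ones). -/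
noncomputable def maxCodeSize (M : Type*) [MetricSpace M] (F : ℝ → ℝ) (S : Set ℝ) : ℕ∞ :=
  ⨆ (C : Finset M) (_ : IsCode F S C), (C.card : ℕ∞)

/-- The Hankel matrix `R_m` of `s_0, …, s_{2m-2}`. -/
def hankelR (m : ℕ) (s : ℕ → ℝ) : Matrix (Fin m) (Fin m) ℝ :=
  Matrix.of fun i j => s (i + j)

/-- The matrix `F_m^+(a)`. -/
def hankelPlus (m : ℕ) (s : ℕ → ℝ) (a : ℝ) : Matrix (Fin m) (Fin m) ℝ :=
  Matrix.of fun i j => s (i + j + 1) - a * s (i + j)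

/-- The matrix `F_m^-(b)`. -/
def hankelMinus (m : ℕ) (s : ℕ → ℝ) (b : ℝ) : Matrix (Fin m) (Fin m) ℝ :=
  Matrix.of fun i j => b * s (i + j) - s (i + j + 1)

/-- The block diagonal matrix `H_m(s_0, …, s_{2m-1}, [a,b])`. -/
def hankelH (m : ℕ) (s : ℕ → ℝ) (a b : ℝ) :
    Matrix (Fin m ⊕ (Fin m ⊕ Fin m)) (Fin m ⊕ (Fin m ⊕ Fin m)) ℝ :=
  Matrix.fromBlocks (hankelR m s) 0 0
    (Matrix.fromBlocks (hankelPlus m s a) 0 0 (hankelMinus m s b))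

/-- The sequence `1, x_1, …, x_{2m-1}` (continued by zeros, which are never used); the variable `x_k`
is the entry of `x` with index `k - 1`. -/
def normalizedMoments (m : ℕ) (x : Fin (2 * m - 1) → ℝ) (k : ℕ) : ℝ :=
  if k = 0 then 1 else if h : k - 1 < 2 * m - 1 then x ⟨k - 1, h⟩ else 0

/-- The matrix `H̄_m(x_1, …, x_{2m-1}, [a,b]) = H_m(1, x_1, …, x_{2m-1}, [a,b])`. -/
def hankelHBar (m : ℕ) (x : Fin (2 * m - 1) → ℝ) (a b : ℝ) :
    Matrix (Fin m ⊕ (Fin m ⊕ Fin m)) (Fin m ⊕ (Fin m ⊕ Fin m)) ℝ :=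
  hankelH m (normalizedMoments m x) a b

/-- The constraints of the problem `SDP_0` for given `m`, with `p_{ki}` the coefficients of `Φ_k`; the
linear constraints run over those `k = 1, …, 2m-1` for which `Φ_k` exists, i.e. `k ∈ I`. -/
def IsSDPZeroFeasible (Φ : ℕ → Polynomial ℝ) (I : Set ℕ) (a b : ℝ) (m : ℕ)
    (y : ℝ) (x : Fin (2 * m - 1) → ℝ) : Prop :=
  (∀ k ∈ Finset.Icc 1 (2 * m - 1), k ∈ I →
    y + ∑ i ∈ Finset.Icc 1 k, (Φ k).coeff i * normalizedMoments m x i ≥ -(Φ k).coeff 0) ∧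
  (hankelHBar m x a b).PosSemidef

/-- `y` is the optimal value of the problem `SDP_0` for given `m`: the infimum of the objective over
all feasible points, whether attained or not (so every minimum is included). -/
def IsSDPZeroOptimum (Φ : ℕ → Polynomial ℝ) (I : Set ℕ) (a b : ℝ) (m : ℕ) (y : ℝ) : Prop :=
  IsGLB {z : ℝ | ∃ x : Fin (2 * m - 1) → ℝ, IsSDPZeroFeasible Φ I a b m z x} y

end TwoPointCodes

/-!
A zonal kernel `K(x,y) = Φ(τ(x,y))` with sections in an irreducible space `V` is positive
semidefinite. Indeed the integral operator with kernel `K` maps `V` to itself and commutes with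
`G`, so by Schur's lemma it is a scalar `c` on `V`; applied to the sections of `K` this reads
`c K(x,z) = ∫ K(x,y) K(z,y) dμ(y)`, a Gram matrix, and `c > 0` because `K > 0` on the diagonal.

For an `S`-code `C` with `N ≥ 2` points, let `x_i` be the average of `τ(x,y)^i` over the ordered
pairs of distinct points of `C`. The Hankel constraints hold because the `x_i` are moments of a
probability measure on `[a,b]`; dividing `∑_{x,y ∈ C} Φ_k(τ(x,y)) ≥ 0` by `N(N-1)` gives the
linear constraints with `y = 1/(N-1)`. Hence `y* ≤ 1/(N-1)`.
-/

namespace TwoPointCodes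

open Polynomial
open scoped BigOperators

section FunctionSpaces

lemma span_range_eval_eq_top {X 𝕜 : Type*} [Field 𝕜] (V : Submodule 𝕜 (X → 𝕜))
    [Module.Finite 𝕜 V] :
    Submodule.span 𝕜 (Set.range fun x => (LinearMap.proj x : (X → 𝕜) →ₗ[𝕜] 𝕜) ∘ₗ V.subtype) =
      (⊤ : Submodule 𝕜 (Module.Dual 𝕜 V)) := by
  refine Submodule.span_eq_top_of_ne_zero fun f hf => ?_
  obtain ⟨x, hx⟩ := Function.ne_iff.1 fun h => hf (Subtype.ext h)
  exact ⟨_, ⟨x, rfl⟩, hx⟩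

lemma integral_mem_of_finiteDimensional {X Y 𝕜 : Type*} [RCLike 𝕜] [MeasurableSpace Y]
    {μ : Measure Y} (V : Submodule 𝕜 (X → 𝕜)) [Module.Finite 𝕜 V] {u : Y → X → 𝕜}
    (hu : ∀ y, u y ∈ V) (hint : ∀ x, Integrable (fun y => u y x) μ) :
    (fun x => ∫ y, u y x ∂μ) ∈ V := by
  have hdual (l : Module.Dual 𝕜 V) : Integrable (fun y => l ⟨u y, hu y⟩) μ := by
    have hl : l ∈ Submodule.span 𝕜 _ := (span_range_eval_eq_top V).ge Submodule.mem_top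
    induction hl using Submodule.span_induction with
    | mem l hl => obtain ⟨x, rfl⟩ := hl; exact hint x
    | zero => exact integrable_zero _ _ _
    | add l l' _ _ hl hl' => exact hl.add hl'
    | smul a l _ hl => exact hl.const_mul a
  -- The weak integral is a functional on the dual, hence an element of `V` by reflexivity.
  let J : Module.Dual 𝕜 (Module.Dual 𝕜 V) :=
    { toFun l := ∫ y, l ⟨u y, hu y⟩ ∂μ
      map_add' l l' := integral_add (hdual l) (hdual l')
      map_smul' a l := integral_const_mul a _ }
  convert ((Module.evalEquiv 𝕜 V).symm J).2 using 1
  ext x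
  exact (Module.apply_evalEquiv_symm_apply 𝕜 V
    ((LinearMap.proj x : (X → 𝕜) →ₗ[𝕜] 𝕜) ∘ₗ V.subtype) J).symm

/-- A `G`-invariant space of complex functions on `M` that is irreducible as a representation:
it is nonzero and its only invariant subspaces are itself and `0`. -/
structure IsIrreducibleSpace (G : Type*) {M : Type*} [Group G] [MulAction G M]
    (V : Submodule ℂ (M → ℂ)) : Prop where
  invariant : IsInvariantSpace G V
  ne_bot : V ≠ ⊥
  eq_bot_or_eq : ∀ W ≤ V, IsInvariantSpace G W → W = ⊥ ∨ W = V

lemma IsIrreducibleSpace.exists_eq_smul {G M : Type*} [Group G] [MulAction G M]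
    {V : Submodule ℂ (M → ℂ)} [Module.Finite ℂ V] (hV : IsIrreducibleSpace G V)
    (A : Module.End ℂ V)
    (hA : ∀ (g : G) (f : V) (x : M),
      (A ⟨_, hV.invariant g f f.2⟩ : M → ℂ) x = (A f : M → ℂ) (g • x)) :
    ∃ c : ℂ, ∀ f, A f = c • f := by
  have : Nontrivial V := Submodule.nontrivial_iff_ne_bot.2 hV.ne_bot
  obtain ⟨c, hc⟩ := Module.End.exists_eigenvalue A
  have hinv : IsInvariantSpace G ((A.eigenspace c).map V.subtype) := by
    rintro g _ ⟨f, hf, rfl⟩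
    refine ⟨⟨_, hV.invariant g f f.2⟩, Module.End.mem_eigenspace_iff.2 ?_, rfl⟩
    ext x
    simp [hA, Module.End.mem_eigenspace_iff.1 hf]
  have hne : (A.eigenspace c).map V.subtype ≠ ⊥ := fun h =>
    hc (Submodule.map_injective_of_injective V.injective_subtype
      (h.trans (Submodule.map_bot _).symm))
  have htop : A.eigenspace c = ⊤ := by
    refine Submodule.map_injective_of_injective V.injective_subtype ?_
    rw [(hV.eq_bot_or_eq _ (Submodule.map_subtype_le V _) hinv).resolve_left hne,
      Submodule.map_subtype_top]
  exact ⟨c, fun f => Module.End.mem_eigenspace_iff.1 (htop ▸ Submodule.mem_top)⟩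

end FunctionSpaces

lemma posSemidef_integral_mul {ι X : Type*} [MeasurableSpace X] {μ : Measure X} {f : ι → X → ℝ}
    (hf : ∀ i j, Integrable (fun x => f i x * f j x) μ) :
    (Matrix.of fun i j => ∫ x, f i x * f j x ∂μ).PosSemidef := by
  refine ⟨Matrix.IsHermitian.ext fun i j => by simp [mul_comm], fun w => ?_⟩
  have hint (i j : ι) : Integrable (fun x => w i * f i x * (w j * f j x)) μ :=
    ((hf i j).const_mul (w i * w j)).congr (.of_forall fun x => by ring)
  calc
    0 ≤ ∫ x, (∑ i ∈ w.support, w i * f i x) * ∑ j ∈ w.support, w j * f j x ∂μ :=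
      integral_nonneg fun x => mul_self_nonneg _
    _ = ∑ i ∈ w.support, ∑ j ∈ w.support, ∫ x, w i * f i x * (w j * f j x) ∂μ := by
      simp_rw [Finset.sum_mul_sum]
      rw [integral_finsetSum _ fun i _ => integrable_finsetSum _ fun j _ => hint i j]
      exact Finset.sum_congr rfl fun i _ => integral_finsetSum _ fun j _ => hint i j
    _ = w.sum fun i wi => w.sum fun j wj =>
          star wi * (Matrix.of fun i j => ∫ x, f i x * f j x ∂μ) i j * wj := by
      refine Finset.sum_congr rfl fun i _ => Finset.sum_congr rfl fun j _ => ?_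
      simp only [Matrix.of_apply, star_trivial, ← integral_const_mul, ← integral_mul_const]
      exact integral_congr_ae (.of_forall fun x => by ring)

lemma sum_sum_nonneg_of_posSemidef {ι : Type*} {A : Matrix ι ι ℝ} (hA : A.PosSemidef)
    (s : Finset ι) : 0 ≤ ∑ i ∈ s, ∑ j ∈ s, A i j := by
  have h := (hA.submatrix ((↑) : s → ι)).dotProduct_mulVec_nonneg 1
  simpa only [dotProduct, Matrix.mulVec, Matrix.submatrix_apply, star_one, Pi.one_apply, one_mul,
    mul_one, ← Finset.sum_coe_sort s] using h

/-- A zonal kernel: a symmetric real kernel on `M`, invariant under the diagonal action of `G`,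
whose sections belong to the function space `V`. -/
structure IsZonalKernel (G : Type*) {M : Type*} [Group G] [MulAction G M]
    (V : Submodule ℂ (M → ℂ)) (K : M → M → ℝ) : Prop where
  symm : ∀ x y, K x y = K y x
  smul_smul : ∀ (g : G) (x y : M), K (g • x) (g • y) = K x y
  section_mem : ∀ y, (fun x => (K x y : ℂ)) ∈ V

namespace IsZonalKernel

variable {G M : Type*} [TopologicalSpace M] [Group G] [MulAction G M]
  {V : Submodule ℂ (M → ℂ)} {K : M → M → ℝ}

lemma continuous_apply (hK : IsZonalKernel G V K) (hcont : ∀ f ∈ V, Continuous f) (x : M) :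
    Continuous (K x) := by
  rw [funext (hK.symm x)]
  exact Complex.continuous_re.comp (hcont _ (hK.section_mem x))

variable [CompactSpace M] [MeasurableSpace M] [OpensMeasurableSpace M] {μ : Measure M}
  [IsFiniteMeasureOnCompacts μ]

lemma integrable_mul (hK : IsZonalKernel G V K) (hcont : ∀ f ∈ V, Continuous f) {f : M → ℂ}
    (hf : f ∈ V) (x : M) : Integrable (fun y => (K x y : ℂ) * f y) μ :=
  ((Complex.continuous_ofReal.comp (hK.continuous_apply hcont x)).mul
    (hcont f hf)).integrable_of_hasCompactSupport (.of_compactSpace _)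

lemma integral_mul_mem [Module.Finite ℂ V] (hK : IsZonalKernel G V K)
    (hcont : ∀ f ∈ V, Continuous f) {f : M → ℂ} (hf : f ∈ V) :
    (fun x => ∫ y, (K x y : ℂ) * f y ∂μ) ∈ V := by
  refine integral_mem_of_finiteDimensional V (u := fun y x => (K x y : ℂ) * f y) (fun y => ?_)
    (hK.integrable_mul hcont hf)
  simpa only [mul_comm, Pi.smul_def, smul_eq_mul] using V.smul_mem (f y) (hK.section_mem y)

variable [MeasurableConstSMul G M] [SMulInvariantMeasure G M μ] [Module.Finite ℂ V]

lemma exists_integral_mul_eq (hK : IsZonalKernel G V K) (hV : IsIrreducibleSpace G V)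
    (hcont : ∀ f ∈ V, Continuous f) :
    ∃ c : ℂ, ∀ f ∈ V, ∀ x, ∫ y, (K x y : ℂ) * f y ∂μ = c * f x := by
  let A : Module.End ℂ V :=
    { toFun f := ⟨fun x => ∫ y, (K x y : ℂ) * f.1 y ∂μ, hK.integral_mul_mem hcont f.2⟩
      map_add' f f' := by
        ext x
        simpa only [Submodule.coe_add, Pi.add_apply, mul_add] using
          integral_add (hK.integrable_mul hcont f.2 x) (hK.integrable_mul hcont f'.2 x)
      map_smul' a f := by
        ext x
        simpa only [Submodule.coe_smul, Pi.smul_apply, smul_eq_mul, RingHom.id_apply,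
          mul_left_comm a] using integral_const_mul a fun y => (K x y : ℂ) * f.1 y }
  obtain ⟨c, hc⟩ := hV.exists_eq_smul A fun g f x => by
    simpa only [A, LinearMap.coe_mk, AddHom.coe_mk, hK.smul_smul] using
      integral_smul_eq_self (μ := μ) (fun y => (K (g • x) y : ℂ) * f.1 y) (g := g)
  exact ⟨c, fun f hf x => congrFun (congrArg Subtype.val (hc ⟨f, hf⟩)) x⟩

lemma exists_integral_mul_self_eq (hK : IsZonalKernel G V K) (hV : IsIrreducibleSpace G V)
    (hcont : ∀ f ∈ V, Continuous f) :
    ∃ c : ℝ, ∀ x z, ∫ y, K x y * K z y ∂μ = c * K x z := by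
  obtain ⟨c, hc⟩ := hK.exists_integral_mul_eq (μ := μ) hV hcont
  refine ⟨c.re, fun x z => ?_⟩
  have h : ((∫ y, K x y * K z y ∂μ : ℝ) : ℂ) = c * (K x z : ℂ) := by
    simpa only [hK.symm z, ← Complex.ofReal_mul, integral_complex_ofReal] using
      hc _ (hK.section_mem z) x
  simpa using congrArg Complex.re h

lemma posSemidef (hK : IsZonalKernel G V K) (hV : IsIrreducibleSpace G V)
    (hcont : ∀ f ∈ V, Continuous f) (μ : Measure M) [IsFiniteMeasureOnCompacts μ]
    [SMulInvariantMeasure G M μ] [μ.IsOpenPosMeasure] {x₀ : M} (hx₀ : 0 < K x₀ x₀) :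
    (Matrix.of K).PosSemidef := by
  obtain ⟨c, hc⟩ := hK.exists_integral_mul_self_eq (μ := μ) hV hcont
  have hKc (x z : M) : Continuous fun y => K x y * K z y :=
    (hK.continuous_apply hcont x).mul (hK.continuous_apply hcont z)
  have hc_pos : 0 < c := by
    refine pos_of_mul_pos_left ?_ hx₀.le
    rw [← hc]
    exact (hKc x₀ x₀).integral_pos_of_hasCompactSupport_nonneg_nonzero (.of_compactSpace _)
      (fun y => mul_self_nonneg _) (mul_self_ne_zero.2 hx₀.ne')
  have hgram : Matrix.of K = c⁻¹ • Matrix.of fun x z => ∫ y, K x y * K z y ∂μ := by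
    ext x z
    simp [hc, hc_pos.ne']
  rw [hgram]
  exact (posSemidef_integral_mul fun x z =>
    (hKc x z).integrable_of_hasCompactSupport (.of_compactSpace _)).smul (inv_nonneg.2 hc_pos.le)

end IsZonalKernel

/-- The polynomial `p` is a zonal spherical function in the variable `τ = F ∘ ρ`: `p(τ(x,x)) = 1`,
and the functions `x ↦ p(τ(x,y))` lie in a common irreducible finite-dimensional `G`-invariant
space of continuous functions. -/
def IsZonalPolynomial (G : Type*) {M : Type*} [MetricSpace M] [Group G] [MulAction G M]
    (F : ℝ → ℝ) (p : ℝ[X]) : Prop :=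
  p.eval (F 0) = 1 ∧ ∃ V : Submodule ℂ (M → ℂ), Module.Finite ℂ V ∧ (∀ f ∈ V, Continuous f) ∧
    IsIrreducibleSpace G V ∧ ∀ y : M, (fun x : M => ((p.eval (tau F x y) : ℝ) : ℂ)) ∈ V

lemma IsZonalPolynomial.sum_sum_eval_tau_nonneg {G M : Type*} [MetricSpace M] [CompactSpace M]
    [MeasurableSpace M] [BorelSpace M] [Group G] [MulAction G M] [IsIsometricSMul G M]
    (μ : Measure M) [IsFiniteMeasureOnCompacts μ] [μ.IsOpenPosMeasure] [SMulInvariantMeasure G M μ]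
    {F : ℝ → ℝ} {p : ℝ[X]} (hp : IsZonalPolynomial G (M := M) F p) (C : Finset M) :
    0 ≤ ∑ x ∈ C, ∑ z ∈ C, p.eval (tau F x z) := by
  obtain ⟨hone, V, hfin, hcont, hV, hmem⟩ := hp
  have hK : IsZonalKernel G V fun x z => p.eval (tau F x z) :=
    { symm x z := by rw [tau, tau, dist_comm]
      smul_smul g x z := by rw [tau, tau, dist_smul]
      section_mem := hmem }
  obtain rfl | ⟨x₀, -⟩ := C.eq_empty_or_nonempty
  · simp
  · refine sum_sum_nonneg_of_posSemidef (hK.posSemidef hV hcont μ (x₀ := x₀) ?_) C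
    simp [tau, hone]

section Hankel

lemma posSemidef_fromBlocks_zero {m n R : Type*} [Finite m] [Finite n] [Ring R] [PartialOrder R]
    [StarRing R] [AddLeftMono R] {A : Matrix m m R} {D : Matrix n n R} (hA : A.PosSemidef)
    (hD : D.PosSemidef) : (Matrix.fromBlocks A 0 0 D).PosSemidef := by
  cases nonempty_fintype m
  cases nonempty_fintype n
  refine .of_dotProduct_mulVec_nonneg
    (hA.isHermitian.fromBlocks Matrix.conjTranspose_zero hD.isHermitian) fun v => ?_
  simpa [Matrix.fromBlocks_mulVec, dotProduct, Fintype.sum_sum_type] using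
    add_nonneg (hA.dotProduct_mulVec_nonneg (v ∘ Sum.inl))
      (hD.dotProduct_mulVec_nonneg (v ∘ Sum.inr))

variable {ι : Type*} {a b : ℝ}

lemma posSemidef_hankelH_pow {t : ℝ} (ht : t ∈ Set.Icc a b) (m : ℕ) :
    (hankelH m (fun k => t ^ k) a b).PosSemidef := by
  let v : Fin m → ℝ := fun i => t ^ (i : ℕ)
  have hv : (Matrix.vecMulVec v (star v)).PosSemidef := Matrix.posSemidef_vecMulVec_self_star v
  have hR : hankelR m (fun k => t ^ k) = Matrix.vecMulVec v (star v) := by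
    ext i j
    simp [hankelR, v, Matrix.vecMulVec_apply, pow_add]
  have hPlus : hankelPlus m (fun k => t ^ k) a = (t - a) • Matrix.vecMulVec v (star v) := by
    ext i j
    simp only [hankelPlus, v, Matrix.of_apply, Matrix.smul_apply, Matrix.vecMulVec_apply,
      star_trivial, smul_eq_mul]
    ring
  have hMinus : hankelMinus m (fun k => t ^ k) b = (b - t) • Matrix.vecMulVec v (star v) := by
    ext i j
    simp only [hankelMinus, v, Matrix.of_apply, Matrix.smul_apply, Matrix.vecMulVec_apply,
      star_trivial, smul_eq_mul]
    ring
  rw [hankelH, hR, hPlus, hMinus]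
  exact posSemidef_fromBlocks_zero hv (posSemidef_fromBlocks_zero
    (hv.smul (sub_nonneg.2 ht.1)) (hv.smul (sub_nonneg.2 ht.2)))

lemma hankelH_expect (P : Finset ι) (s : ι → ℕ → ℝ) (m : ℕ) (a b : ℝ) :
    hankelH m (fun k => 𝔼 i ∈ P, s i k) a b = 𝔼 i ∈ P, hankelH m (s i) a b := by
  have happly (i j) : (𝔼 p ∈ P, hankelH m (s p) a b) i j = 𝔼 p ∈ P, hankelH m (s p) a b i j := by
    simp only [Finset.expect, Matrix.smul_apply, Matrix.sum_apply]
  ext (i | i | i) (j | j | j) <;> rw [happly] <;>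
    simp [hankelH, hankelR, hankelPlus, hankelMinus, Finset.mul_expect, Finset.expect_sub_distrib]

lemma posSemidef_hankelH_expect_pow (P : Finset ι) {t : ι → ℝ} (ht : ∀ i ∈ P, t i ∈ Set.Icc a b)
    (m : ℕ) : (hankelH m (fun k => 𝔼 i ∈ P, t i ^ k) a b).PosSemidef := by
  rw [hankelH_expect P (fun i k => t i ^ k)]
  exact (Matrix.posSemidef_sum P fun i hi => posSemidef_hankelH_pow (ht i hi) m).smul
    (by positivity)

lemma hankelH_congr {m : ℕ} {s s' : ℕ → ℝ} (h : ∀ k < 2 * m, s k = s' k) (a b : ℝ) :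
    hankelH m s a b = hankelH m s' a b := by
  have h1 (i j : Fin m) : s (i + j) = s' (i + j) := h _ (by omega)
  have h2 (i j : Fin m) : s (i + j + 1) = s' (i + j + 1) := h _ (by omega)
  simp only [hankelH, hankelR, hankelPlus, hankelMinus, h1, h2]

lemma normalizedMoments_of_lt {m : ℕ} {s : ℕ → ℝ} (h0 : s 0 = 1) {k : ℕ} (hk : k < 2 * m) :
    normalizedMoments m (fun i => s (i + 1)) k = s k := by
  cases k with
  | zero => exact h0.symm
  | succ k => simp [normalizedMoments, show k < 2 * m - 1 by omega]

end Hankel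

section Codes

lemma expect_eval_eq_coeff_zero_add {ι : Type*} {P : Finset ι} (hP : P.Nonempty) (t : ι → ℝ)
    {p : ℝ[X]} {k : ℕ} (hp : p.natDegree ≤ k) :
    𝔼 i ∈ P, p.eval (t i) = p.coeff 0 + ∑ j ∈ Finset.Icc 1 k, p.coeff j * 𝔼 i ∈ P, t i ^ j := by
  simp_rw [Polynomial.eval_eq_sum_range' (Nat.lt_succ_of_le hp), Finset.expect_sum_comm,
    ← Finset.mul_expect]
  rw [Finset.range_eq_Ico, Finset.sum_eq_sum_Ico_succ_bot k.succ_pos]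
  simp [hP, Finset.Ico_add_one_right_eq_Icc]

lemma neg_inv_card_sub_one_le_expect_offDiag {ι : Type*} {f : ι → ι → ℝ} {C : Finset ι}
    (hC : 1 < C.card) (hdiag : ∀ x ∈ C, f x x = 1)
    (hf : 0 ≤ ∑ x ∈ C, ∑ z ∈ C, f x z) :
    -(C.card - 1 : ℝ)⁻¹ ≤ 𝔼 q ∈ C.offDiag, f q.1 q.2 := by
  classical
  have hcard : (1 : ℝ) < C.card := mod_cast hC
  have hoffDiag : (C.offDiag.card : ℝ) = C.card * (C.card - 1) := by
    rw [Finset.offDiag_card, Nat.cast_sub (Nat.le_mul_self _), Nat.cast_mul]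
    ring
  have hsplit : ∑ x ∈ C, ∑ z ∈ C, f x z = C.card + ∑ q ∈ C.offDiag, f q.1 q.2 := by
    rw [← Finset.sum_product', ← Finset.diag_union_offDiag,
      Finset.sum_union (Finset.disjoint_diag_offDiag C), Finset.sum_diag,
      Finset.sum_congr rfl hdiag]
    simp
  rw [Finset.expect_eq_sum_div_card, hoffDiag, le_div_iff₀ (by nlinarith)]
  have : (C.card - 1 : ℝ) ≠ 0 := by linarith
  field_simp
  linarith

variable {M : Type*} [MetricSpace M] {F : ℝ → ℝ} {Φ : ℕ → ℝ[X]} {I : Set ℕ} {a b : ℝ}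
  {S : Set ℝ} {m : ℕ} {C : Finset M}

/-- The `k`-th moment of the distance distribution of the code `C`: the average of `τ(x,y) ^ k`
over the ordered pairs of distinct points of `C`. It is `0` if `C` has at most one point. -/
noncomputable def distanceMoment (F : ℝ → ℝ) (C : Finset M) (k : ℕ) : ℝ :=
  𝔼 q ∈ C.offDiag, tau F q.1 q.2 ^ k

lemma isSDPZeroFeasible_distanceMoment (hdeg : ∀ k ∈ I, (Φ k).natDegree ≤ k)
    (hone : ∀ k ∈ I, (Φ k).eval (F 0) = 1)
    (hpos : ∀ k ∈ I, 0 ≤ ∑ x ∈ C, ∑ z ∈ C, (Φ k).eval (tau F x z))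
    (hS : S ⊆ Set.Icc a b) (hC : IsCode F S C) (hcard : 1 < C.card) :
    IsSDPZeroFeasible Φ I a b m (C.card - 1 : ℝ)⁻¹ fun i => distanceMoment F C (i + 1) := by
  have hne : C.offDiag.Nonempty := by
    obtain ⟨x, hx, y, hy, hxy⟩ := Finset.one_lt_card.1 hcard
    exact ⟨(x, y), Finset.mem_offDiag.2 ⟨hx, hy, hxy⟩⟩
  have hmom (k : ℕ) (hk : k < 2 * m) :
      normalizedMoments m (fun i => distanceMoment F C (i + 1)) k = distanceMoment F C k :=
    normalizedMoments_of_lt (by simp [distanceMoment, hne]) hk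
  refine ⟨fun k hk hkI => ?_, ?_⟩
  · have hle := neg_inv_card_sub_one_le_expect_offDiag hcard
      (fun x _ => by simpa [tau] using hone k hkI) (hpos k hkI)
    rw [expect_eval_eq_coeff_zero_add hne (fun q => tau F q.1 q.2) (hdeg k hkI)] at hle
    rw [Finset.sum_congr rfl fun i hi => by
      rw [hmom i (by simp only [Finset.mem_Icc] at hi hk; omega), distanceMoment]]
    linarith
  · rw [hankelHBar, hankelH_congr hmom]
    refine posSemidef_hankelH_expect_pow _ (fun q hq => ?_) m
    obtain ⟨hx, hy, hxy⟩ := Finset.mem_offDiag.1 hq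
    exact hS (hC _ hx _ hy hxy)

lemma maxCodeSize_le_ofReal {r : ℝ} (h : ∀ C : Finset M, IsCode F S C → (C.card : ℝ) ≤ r) :
    (maxCodeSize M F S : ℝ≥0∞) ≤ ENNReal.ofReal r := by
  simp only [maxCodeSize, ENat.toENNReal_iSup, ENat.toENNReal_coe]
  refine iSup₂_le fun C hC => ?_
  rw [← ENNReal.ofReal_natCast]
  exact ENNReal.ofReal_le_ofReal (h C hC)

end Codes

lemma IsTwoPointHomogeneous.isIsometricSMul {G M : Type*} [MetricSpace M] [Group G] [MulAction G M]
    (hM : IsTwoPointHomogeneous G M) : IsIsometricSMul G M :=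
  ⟨fun g => .of_dist_eq (hM.isometric g)⟩

lemma IsTwoPointHomogeneous.isPretransitive {G M : Type*} [MetricSpace M] [Group G] [MulAction G M]
    (hM : IsTwoPointHomogeneous G M) : MulAction.IsPretransitive G M where
  exists_smul_eq x y := by
    obtain ⟨g, hg, -⟩ := hM.homogeneous x x y y (by simp only [dist_self])
    exact ⟨g, hg⟩

lemma isOpenPosMeasure_of_smulInvariant (G : Type*) {X : Type*} [TopologicalSpace X]
    [CompactSpace X] [MeasurableSpace X] [Group G] [MulAction G X] [ContinuousConstSMul G X]
    [MulAction.IsMinimal G X] (μ : Measure X) [NeZero μ] [SMulInvariantMeasure G X μ] :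
    μ.IsOpenPosMeasure :=
  ⟨fun _ hU hne => (measure_isOpen_pos_of_smulInvariant_of_compact_ne_zero G isCompact_univ
    (NeZero.ne _) hU hne).ne'⟩

lemma IsZonalFamily.natDegree_eq {G M : Type*} [MetricSpace M] [MeasurableSpace M] [Group G]
    [MulAction G M] {μ : Measure M} {F : ℝ → ℝ} {Φ : ℕ → ℝ[X]} (hΦ : IsZonalFamily G μ F Φ)
    {k : ℕ} (hk : k ∈ zonalIndex M F) : (Φ k).natDegree = k := by
  obtain ⟨V, -, hV⟩ := hΦ
  exact natDegree_eq_of_degree_eq_some (hV k hk).1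

lemma IsZonalFamily.isZonalPolynomial {G M : Type*} [MetricSpace M] [MeasurableSpace M] [Group G]
    [MulAction G M] {μ : Measure M} {F : ℝ → ℝ} {Φ : ℕ → ℝ[X]} (hΦ : IsZonalFamily G μ F Φ)
    {k : ℕ} (hk : k ∈ zonalIndex M F) : IsZonalPolynomial G (M := M) F (Φ k) := by
  obtain ⟨V, hV, hΦ⟩ := hΦ
  exact ⟨(hΦ k hk).2.1, V k, hV.finite k hk, hV.continuous k hk,
    ⟨hV.invariant k hk, hV.nontrivial k hk, hV.irreducible k hk⟩, (hΦ k hk).2.2⟩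

end TwoPointCodes

open TwoPointCodes in
theorem theorem4p1_general {M G : Type*} [MetricSpace M] [CompactSpace M] [MeasurableSpace M]
    [BorelSpace M] [Group G] [MulAction G M] [IsIsometricSMul G M]
    (μ : Measure M) [IsFiniteMeasureOnCompacts μ] [μ.IsOpenPosMeasure] [SMulInvariantMeasure G M μ]
    {F : ℝ → ℝ} {Φ : ℕ → Polynomial ℝ} {I : Set ℕ} (hdeg : ∀ k ∈ I, (Φ k).natDegree ≤ k)
    (hΦ : ∀ k ∈ I, IsZonalPolynomial G (M := M) F (Φ k))
    {a b : ℝ} {S : Set ℝ} (hS : S ⊆ Set.Icc a b) {m : ℕ} {y : ℝ}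
    (hy : y ∈ lowerBounds {z | ∃ x, IsSDPZeroFeasible Φ I a b m z x}) (hpos : 0 < y) :
    (maxCodeSize M F S : ℝ≥0∞) ≤ ENNReal.ofReal ((1 + y) / y) := by
  refine maxCodeSize_le_ofReal fun C hC => ?_
  rw [le_div_iff₀ hpos]
  rcases le_or_gt C.card 1 with hcard | hcard
  · have : (C.card : ℝ) ≤ 1 := mod_cast hcard
    nlinarith
  · have hle : y ≤ (C.card - 1 : ℝ)⁻¹ := hy ⟨_, isSDPZeroFeasible_distanceMoment hdeg
      (fun k hk => (hΦ k hk).1) (fun k hk => (hΦ k hk).sum_sum_eval_tau_nonneg μ C) hS hC hcard⟩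
    have hcard' : (0 : ℝ) < C.card - 1 := sub_pos.2 (mod_cast hcard)
    rw [inv_eq_one_div, le_div_iff₀ hcard'] at hle
    linarith

theorem theorem4p1 {M G : Type*} [MetricSpace M] [CompactSpace M] [MeasurableSpace M]
    [BorelSpace M] [Group G] [MulAction G M]
    (hM : TwoPointCodes.IsTwoPointHomogeneous G M)
    (μ : Measure M) [IsProbabilityMeasure μ] [SMulInvariantMeasure G M μ]
    (F : ℝ → ℝ) (Φ : ℕ → Polynomial ℝ) (hΦ : TwoPointCodes.IsZonalFamily G μ F Φ)
    (a b : ℝ) (m : ℕ) (hm : 1 ≤ m) (yopt : ℝ)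
    (hy : TwoPointCodes.IsSDPZeroOptimum Φ (TwoPointCodes.zonalIndex M F) a b m yopt)
    (hpos : 0 < yopt) :
    (TwoPointCodes.maxCodeSize M F (TwoPointCodes.tauRange M F ∩ Set.Icc a b) : ℝ≥0∞) ≤
      ENNReal.ofReal ((1 + yopt) / yopt) := by
  have := hM.isIsometricSMul
  have := hM.isPretransitive
  have := TwoPointCodes.isOpenPosMeasure_of_smulInvariant G μ
  exact theorem4p1_general μ (fun k hk => (hΦ.natDegree_eq hk).le) (fun k => hΦ.isZonalPolynomial)
    Set.inter_subset_right hy.1 hpos
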